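/- Let $n \ge 0$ be an integer. Let $\mathcal K_n$ be the set of all convex bodies of $\mathbb R^n$ (compact convex subsets of $\mathbb R^n$ with nonempty interior), equipped with the Hausdorff distance for the Euclidean metric, and let $\mathrm{Aff}(n)$ be the group of all nonsingular affine maps of $\mathbb R^n$, acting on $\mathcal K_n$ by $gK = \{gx \mid x \in K\}$. An affine invariant point is a continuous map $p : \mathcal K_n \to \mathbb R^n$ such that $p(gA) = g\,p(A)$ for every $g \in \mathrm{Aff}(n)$ and every $A \in \mathcal K_n$. For $K \in \mathcal K_n$ put $$\mathfrak P_n(K) = \{p(K) \mid p \text{ is an affine invariant point}\},$$ $$\mathfrak F_n(K) = \{x \in \mathbb R^n \mid gx = x \text{ for every } g \in \mathrm{Aff}(n) \text{ such that } gK = K\}.$$ **Theorem** (Grünbaum's conjecture). Let $K \in \mathcal K_n$. For every $x \in \mathfrak F_n(K)$ there is an affine invariant point $p$ such that $p(K) = x$. Consequently $\mathfrak P_n(K) = \mathfrak F_n(K)$. -/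

import Mathlib

/-- The Euclidean space `ℝⁿ`. -/
abbrev Eucl (n : ℕ) : Type := EuclideanSpace ℝ (Fin n)

/-- The space of convex bodies of `ℝⁿ`: compact convex subsets of `ℝⁿ` with nonempty interior.
(Mathlib's `ConvexBody` asks only for a nonempty compact convex set.) As a subtype it carries the
Hausdorff metric of `ConvexBody`. -/
abbrev SolidBody (n : ℕ) : Type :=
  {K : ConvexBody (Eucl n) // (interior (K : Set (Eucl n))).Nonempty}

/-- The group of all nonsingular affine maps of `ℝⁿ`. -/
abbrev Aff (n : ℕ) : Type := Eucl n ≃ᵃ[ℝ] Eucl n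

namespace SolidBody

variable {n : ℕ}

/-- The underlying set of a convex body. -/
def carrier (K : SolidBody n) : Set (Eucl n) := (K.1 : Set (Eucl n))

/-- The metric on the space of convex bodies is the Hausdorff distance for the Euclidean metric. -/
theorem dist_eq_hausdorffDist (K L : SolidBody n) :
    dist K L = Metric.hausdorffDist K.carrier L.carrier :=
  rfl

/-- The action of the affine group on convex bodies, `gK = {gx | x ∈ K}`. -/
noncomputable def map (g : Aff n) (K : SolidBody n) : SolidBody n :=
  ⟨{ carrier := (fun x => g x) '' K.carrier
     convex' := K.1.convex.affine_image g.toAffineMap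
     isCompact' := K.1.isCompact.image g.toAffineMap.continuous_of_finiteDimensional
     nonempty' := K.1.nonempty.image _ }, by
    obtain ⟨x, hx⟩ := K.2
    exact ⟨g x, ((AffineEquiv.toContinuousAffineEquiv g).toHomeomorph.isOpenMap.image_interior_subset _)
      (Set.mem_image_of_mem _ hx)⟩⟩

@[simp] theorem carrier_map (g : Aff n) (K : SolidBody n) :
    (K.map g).carrier = (fun x => g x) '' K.carrier := rfl

end SolidBody

/-- Affine invariant points: continuous maps `p` from the convex bodies of `ℝⁿ` to `ℝⁿ` with
`p (gK) = g (p K)` for all nonsingular affine maps `g` and all convex bodies `K`. -/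
def affineInvariantPoints (n : ℕ) : Set (SolidBody n → Eucl n) :=
  {p | Continuous p ∧ ∀ (g : Aff n) (K : SolidBody n), p (K.map g) = g (p K)}

/-- The set `𝔓ₙ(K)` of the values at `K` of all affine invariant points. -/
def affineInvariantValues {n : ℕ} (K : SolidBody n) : Set (Eucl n) :=
  {x | ∃ p ∈ affineInvariantPoints n, p K = x}

/-- The set `𝔉ₙ(K)` of the points that are fixed by every nonsingular affine map preserving `K`. -/
def affineFixedPoints {n : ℕ} (K : SolidBody n) : Set (Eucl n) :=
  {x | ∀ g : Aff n, K.map g = K → g x = x}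

/-! Affine combinations of affine invariant points are affine invariant points, so the values at `K`
form an affine subspace of `ℝⁿ`, which is closed (`affineInvariantValuesSubspace`). It therefore
suffices to approximate a fixed point `x` by values.

Invariant points arise by averaging. Fix a small ball `S`. The affine endomorphisms `v` mapping `S`
into a body `A` form a compact convex set with nonempty interior. Take the mean of `v x` over it for
Haar measure, with a weight `w v A` satisfying `w (gv) (gA) = w v A`. Replacing `v` by `gv`
multiplies Haar measure by a constant, which cancels in the mean, so the mean is equivariant; it is
continuous in `A` because convex sets have null frontier (`continuous_setIntegral_mapsInto`).

Take for `w` a bump that is positive only when `v⁻¹A` is `ε`-close to `K`. At `A = K` only `v` that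
nearly preserve `K` count; by compactness they are near symmetries of `K`, which fix `x`, so the
mean is close to `x` (`exists_bump_concentrated`). For other `A` the total weight may vanish, so the
bump mean need not be defined everywhere. At `K`, however, it is an affine combination of the means
for the weights `1` and `1 + w`, which are invariant points
(`smul_moment_mem_affineInvariantValues`). -/

open MeasureTheory Filter Topology

/-- The affine endomorphisms `y ↦ b + M y` of `ℝⁿ`, as pairs `(b, M)`. -/
abbrev AffEndo (n : ℕ) : Type := Eucl n × (Eucl n →L[ℝ] Eucl n)

/-! ### Affine endomorphisms and their action on compact convex sets. -/

namespace AffEndo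

variable {n : ℕ}

/-- The value of an affine endomorphism at a point. -/
def ev (v : AffEndo n) (y : Eucl n) : Eucl n := v.1 + v.2 y

theorem continuous_ev_left (y : Eucl n) : Continuous fun v : AffEndo n => ev v y := by
  unfold ev; fun_prop

theorem continuous_ev (v : AffEndo n) : Continuous (ev v) := by
  unfold ev; fun_prop

theorem ev_sub_ev (v : AffEndo n) (y z : Eucl n) : ev v y - ev v z = v.2 (y - z) := by
  simp [ev]

theorem ev_add_smul (v u : AffEndo n) (a b : ℝ) (y : Eucl n) :
    ev (a • v + b • u) y = a • ev v y + b • ev u y := by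
  simp [ev]; module

theorem dist_ev_ev_le (v : AffEndo n) (y z : Eucl n) :
    dist (ev v y) (ev v z) ≤ ‖v.2‖ * dist y z := by
  rw [dist_eq_norm, ev_sub_ev, dist_eq_norm]; exact v.2.le_opNorm _

theorem dist_ev_le (v u : AffEndo n) {y : Eucl n} {R : ℝ} (hy : ‖y‖ ≤ R) :
    dist (ev v y) (ev u y) ≤ ‖v.1 - u.1‖ + ‖v.2 - u.2‖ * R := by
  have : ev v y - ev u y = (v.1 - u.1) + (v.2 - u.2) y := by simp [ev]; abel
  rw [dist_eq_norm, this]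
  refine (norm_add_le _ _).trans ?_
  gcongr
  exact ((v.2 - u.2).le_opNorm y).trans (by gcongr)

theorem dist_ev_le_dist_mul (v u : AffEndo n) {y : Eucl n} {R : ℝ} (hy : ‖y‖ ≤ R) :
    dist (ev v y) (ev u y) ≤ dist v u * (1 + R) := by
  have h1 : ‖v.1 - u.1‖ ≤ dist v u := by rw [dist_eq_norm]; exact norm_fst_le (v - u)
  have h2 : ‖v.2 - u.2‖ ≤ dist v u := by rw [dist_eq_norm]; exact norm_snd_le (v - u)
  have h3 := mul_le_mul_of_nonneg_right h2 ((norm_nonneg y).trans hy)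
  linarith [dist_ev_le v u hy]

/-- The image of a compact convex set under an affine endomorphism. -/
def imageBody (v : AffEndo n) (A : ConvexBody (Eucl n)) : ConvexBody (Eucl n) where
  carrier := ev v '' A
  convex' := by
    rintro _ ⟨x, hx, rfl⟩ _ ⟨y, hy, rfl⟩ a b ha hb hab
    refine ⟨a • x + b • y, A.convex hx hy ha hb hab, ?_⟩
    have : v.1 = a • v.1 + b • v.1 := by rw [← add_smul, hab, one_smul]
    simp only [ev, map_add, map_smul, smul_add]
    nth_rewrite 1 [this]
    abel
  isCompact' := A.isCompact.image (continuous_ev v)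
  nonempty' := A.nonempty.image _

theorem coe_imageBody (v : AffEndo n) (A : ConvexBody (Eucl n)) :
    (imageBody v A : Set (Eucl n)) = ev v '' A := rfl

end AffEndo

/-! ### Hausdorff distance of compact convex sets. -/

theorem ConvexBody.exists_dist_le_dist {n : ℕ} {A B : ConvexBody (Eucl n)} {x : Eucl n}
    (hx : x ∈ (A : Set (Eucl n))) : ∃ y ∈ (B : Set (Eucl n)), dist x y ≤ dist A B := by
  obtain ⟨y, hy, h⟩ := B.isCompact.exists_infDist_eq_dist B.nonempty x
  refine ⟨y, hy, ?_⟩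
  rw [← h, ← ConvexBody.hausdorffDist_coe]
  exact Metric.infDist_le_hausdorffDist_of_mem hx ConvexBody.hausdorffEDist_ne_top

theorem ConvexBody.dist_le_of_forall_exists {n : ℕ} {A B : ConvexBody (Eucl n)} {r : ℝ}
    (h₁ : ∀ x ∈ (A : Set (Eucl n)), ∃ y ∈ (B : Set (Eucl n)), dist x y ≤ r)
    (h₂ : ∀ x ∈ (B : Set (Eucl n)), ∃ y ∈ (A : Set (Eucl n)), dist x y ≤ r) : dist A B ≤ r := by
  rw [← ConvexBody.hausdorffDist_coe]
  obtain ⟨x, hx⟩ := A.nonempty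
  obtain ⟨y, -, hy⟩ := h₁ x hx
  exact Metric.hausdorffDist_le_of_mem_dist (dist_nonneg.trans hy) h₁ h₂

/-- A ball of a compact convex set is inherited, at its centre, by all compact convex sets that
are closer than its radius. -/
theorem ConvexBody.mem_of_ball_subset {n : ℕ} {A B : ConvexBody (Eucl n)} {x : Eucl n} {δ : ℝ}
    (hx : Metric.ball x δ ⊆ A) (hAB : dist A B < δ) : x ∈ (B : Set (Eucl n)) := by
  by_contra hxB
  obtain ⟨f, u, hfx, hf⟩ := geometric_hahn_banach_point_closed B.convex B.isClosed hxB
  obtain ⟨s, hs, hsδ⟩ := exists_between hAB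
  have hs0 : 0 < s := dist_nonneg.trans_lt hs
  set w := (InnerProductSpace.toDual ℝ (Eucl n)).symm f with hw
  have hfw : ∀ z, f z = inner ℝ w z := fun z => by simp [hw]
  have hw0 : w ≠ 0 := by
    intro h0
    obtain ⟨b, hb⟩ := B.nonempty
    have := hf b hb
    simp only [hfw, h0, inner_zero_left] at this hfx
    linarith
  have hwn : 0 < ‖w‖ := norm_pos_iff.2 hw0
  -- Moving `x` by `s` away from `B`, against the normal `w`, stays in `A` but lowers `f` by `‖w‖ *
  -- s`. A point of `B` within `s` of it would then have `f`-value at most `f x`, on the wrong side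
  -- of the hyperplane.
  have hmem : x - (s / ‖w‖) • w ∈ (A : Set (Eucl n)) := by
    apply hx
    rw [Metric.mem_ball, dist_eq_norm, sub_sub_cancel_left, norm_neg, norm_smul, norm_div,
      norm_norm, div_mul_cancel₀ _ hwn.ne', Real.norm_of_nonneg hs0.le]
    exact hsδ
  obtain ⟨y, hy, hxy⟩ := exists_dist_le_dist (B := B) hmem
  have h1 := hf y hy
  have h2 : f y - f (x - (s / ‖w‖) • w) ≤ ‖w‖ * s := by
    rw [← map_sub, hfw]
    refine (real_inner_le_norm _ _).trans ?_
    gcongr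
    rw [← dist_eq_norm, dist_comm]
    exact hxy.trans hs.le
  have h3 : f (x - (s / ‖w‖) • w) = f x - ‖w‖ * s := by
    rw [map_sub, map_smul, hfw w, real_inner_self_eq_norm_sq, smul_eq_mul]
    field_simp
  linarith

/-! ### Continuity of images, inverses and composition. -/

namespace AffEndo

variable {n : ℕ}

/-- Compare both sides with `uA`: only `A` needs a norm bound, so continuity at `(v, A)` requires no
uniform bound on nearby bodies. -/
theorem dist_imageBody_le (v u : AffEndo n) {A B : ConvexBody (Eucl n)} {R : ℝ}
    (hA : ∀ y ∈ (A : Set (Eucl n)), ‖y‖ ≤ R) :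
    dist (imageBody v A) (imageBody u B) ≤
      ‖v.1 - u.1‖ + ‖v.2 - u.2‖ * R + ‖u.2‖ * dist A B := by
  refine (dist_triangle _ (imageBody u A) _).trans (add_le_add ?_ ?_)
  · apply ConvexBody.dist_le_of_forall_exists
    · rintro _ ⟨y, hy, rfl⟩
      exact ⟨_, ⟨y, hy, rfl⟩, dist_ev_le v u (hA y hy)⟩
    · rintro _ ⟨y, hy, rfl⟩
      exact ⟨_, ⟨y, hy, rfl⟩, by rw [dist_comm]; exact dist_ev_le v u (hA y hy)⟩
  · apply ConvexBody.dist_le_of_forall_exists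
    · rintro _ ⟨y, hy, rfl⟩
      obtain ⟨z, hz, hyz⟩ := ConvexBody.exists_dist_le_dist (B := B) hy
      exact ⟨_, ⟨z, hz, rfl⟩, (dist_ev_ev_le u y z).trans (by gcongr)⟩
    · rintro _ ⟨y, hy, rfl⟩
      obtain ⟨z, hz, hyz⟩ := ConvexBody.exists_dist_le_dist (B := A) hy
      rw [dist_comm B A] at hyz
      exact ⟨_, ⟨z, hz, rfl⟩, (dist_ev_ev_le u y z).trans (by gcongr)⟩

theorem continuous_imageBody :
    Continuous fun p : AffEndo n × ConvexBody (Eucl n) => imageBody p.1 p.2 := by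
  rw [continuous_iff_continuousAt]
  rintro ⟨v, A⟩
  obtain ⟨R, hR⟩ := A.isBounded.exists_norm_le
  rw [ContinuousAt, tendsto_iff_dist_tendsto_zero]
  refine squeeze_zero (fun _ => dist_nonneg) (fun p => ?_) (g := fun p : AffEndo n × _ =>
    ‖v.1 - p.1.1‖ + ‖v.2 - p.1.2‖ * R + ‖p.1.2‖ * dist A p.2) ?_
  · rw [dist_comm]
    exact dist_imageBody_le v p.1 hR
  · have : Continuous fun p : AffEndo n × ConvexBody (Eucl n) =>
        ‖v.1 - p.1.1‖ + ‖v.2 - p.1.2‖ * R + ‖p.1.2‖ * dist A p.2 := by fun_prop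
    simpa using this.tendsto (v, A)

/-- The inverse of an affine endomorphism with invertible linear part. -/
noncomputable def inv (v : AffEndo n) : AffEndo n :=
  (-(Ring.inverse v.2) v.1, Ring.inverse v.2)

theorem ev_inv_ev {v : AffEndo n} (hv : IsUnit v.2) (y : Eucl n) : ev (inv v) (ev v y) = y := by
  have h : Ring.inverse v.2 (v.2 y) = y := DFunLike.congr_fun (Ring.inverse_mul_cancel v.2 hv) y
  simp [ev, inv, h]

theorem ev_ev_inv {v : AffEndo n} (hv : IsUnit v.2) (y : Eucl n) : ev v (ev (inv v) y) = y := by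
  have h z : v.2 (Ring.inverse v.2 z) = z := DFunLike.congr_fun (Ring.mul_inverse_cancel v.2 hv) z
  simp [ev, inv, h]

theorem continuousAt_inv {v : AffEndo n} (hv : IsUnit v.2) : ContinuousAt inv v := by
  have h : ContinuousAt (fun u : AffEndo n => Ring.inverse u.2) v := by
    obtain ⟨x, hx⟩ := hv
    have := NormedRing.inverse_continuousAt x
    rw [hx] at this
    exact this.comp continuousAt_snd
  exact ((h.clm_apply continuousAt_fst).neg).prodMk h

/-- The composition of an affine endomorphism with a nonsingular affine map. -/
noncomputable def comp (g : Aff n) (v : AffEndo n) : AffEndo n :=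
  (g v.1, (LinearMap.toContinuousLinearMap (g.linear : Eucl n →ₗ[ℝ] Eucl n)).comp v.2)

theorem ev_comp (g : Aff n) (v : AffEndo n) (y : Eucl n) : ev (comp g v) y = g (ev v y) := by
  have := g.map_vadd v.1 (v.2 y)
  simp only [vadd_eq_add] at this
  simp [ev, comp, add_comm v.1, this, add_comm (g v.1)]

theorem isUnit_iff_bijective {M : Eucl n →L[ℝ] Eucl n} : IsUnit M ↔ Function.Bijective M :=
  ContinuousLinearMap.isUnit_iff_bijective

theorem isUnit_comp_iff (g : Aff n) (v : AffEndo n) : IsUnit (comp g v).2 ↔ IsUnit v.2 := by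
  rw [isUnit_iff_bijective, isUnit_iff_bijective]
  have : ⇑(comp g v).2 = g.linear ∘ v.2 := by ext; simp [comp]
  rw [this, Function.Bijective.of_comp_iff' g.linear.bijective]

/-- The cancellation `(gv)⁻¹ g = v⁻¹`, which makes `bump` invariant. -/
theorem imageBody_inv_comp (g : Aff n) {v : AffEndo n} (hv : IsUnit v.2) (A : SolidBody n) :
    imageBody (inv (comp g v)) (A.map g).1 = imageBody (inv v) A.1 := by
  have key : ∀ y, ev (inv (comp g v)) (g y) = ev (inv v) y := fun y => by
    conv_lhs => rw [← ev_ev_inv hv y, ← ev_comp]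
    exact ev_inv_ev ((isUnit_comp_iff g v).2 hv) _
  apply SetLike.coe_injective
  rw [coe_imageBody, coe_imageBody]
  change ev _ '' ((fun x => g x) '' A.carrier) = _
  rw [Set.image_image]
  simp only [key]
  rfl

/-! ### The bump weight. -/

/-- The weight of an affine map `v` relative to the convex body `A`: positive if and only if
`v⁻¹A` is at distance less than `ε` from `K`. -/
noncomputable def bump (ε : ℝ) (K : SolidBody n) (v : AffEndo n) (A : SolidBody n) : ℝ :=
  open Classical in if IsUnit v.2 then max 0 (ε - dist (imageBody (inv v) A.1) K.1) else 0

theorem bump_of_isUnit {v : AffEndo n} (hv : IsUnit v.2) (ε : ℝ) (K A : SolidBody n) :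
    bump ε K v A = max 0 (ε - dist (imageBody (inv v) A.1) K.1) := if_pos hv

theorem bump_of_not_isUnit {v : AffEndo n} (hv : ¬ IsUnit v.2) (ε : ℝ) (K A : SolidBody n) :
    bump ε K v A = 0 := if_neg hv

theorem bump_nonneg (ε : ℝ) (K : SolidBody n) (v : AffEndo n) (A : SolidBody n) :
    0 ≤ bump ε K v A := by
  unfold bump; split_ifs <;> simp

theorem bump_le {ε : ℝ} (hε : 0 ≤ ε) (K : SolidBody n) (v : AffEndo n) (A : SolidBody n) :
    bump ε K v A ≤ ε := by
  unfold bump; split_ifs <;> simp [hε]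

theorem bump_comp (ε : ℝ) (K : SolidBody n) (g : Aff n) (v : AffEndo n) (A : SolidBody n) :
    bump ε K (comp g v) (A.map g) = bump ε K v A := by
  by_cases hv : IsUnit v.2
  · rw [bump_of_isUnit hv, bump_of_isUnit ((isUnit_comp_iff g v).2 hv), imageBody_inv_comp g hv]
  · rw [bump_of_not_isUnit hv, bump_of_not_isUnit (mt (isUnit_comp_iff g v).1 hv)]

theorem continuous_bump (ε : ℝ) (K : SolidBody n) (v : AffEndo n) : Continuous (bump ε K v) := by
  by_cases hv : IsUnit v.2
  · have h : Continuous fun A : SolidBody n => imageBody (inv v) A.1 :=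
      continuous_imageBody.comp (continuous_const.prodMk continuous_subtype_val)
    have : bump ε K v = fun A => max 0 (ε - dist (imageBody (inv v) A.1) K.1) :=
      funext fun A => bump_of_isUnit hv ε K A
    rw [this]
    fun_prop
  · have : bump ε K v = fun _ => 0 := funext fun A => bump_of_not_isUnit hv ε K A
    rw [this]
    fun_prop

theorem isOpen_setOf_isUnit : IsOpen {v : AffEndo n | IsUnit v.2} :=
  Units.isOpen.preimage continuous_snd

theorem continuousAt_bump {v : AffEndo n} (hv : IsUnit v.2) (ε : ℝ) (K A : SolidBody n) :
    ContinuousAt (fun v => bump ε K v A) v := by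
  have h : ContinuousAt (fun u : AffEndo n => max 0 (ε - dist (imageBody (inv u) A.1) K.1)) v := by
    have h1 : ContinuousAt (fun u : AffEndo n => imageBody (inv u) A.1) v :=
      ContinuousAt.comp (f := fun u : AffEndo n => (inv u, A.1))
        continuous_imageBody.continuousAt ((continuousAt_inv hv).prodMk continuousAt_const)
    fun_prop
  refine h.congr ?_
  filter_upwards [isOpen_setOf_isUnit.mem_nhds hv] with u hu
  exact (bump_of_isUnit hu ε K A).symm

/-- Continuity across singular `v` is not needed: the weight is continuous on the open set of
invertible `v` and zero off it. -/
theorem measurable_bump (ε : ℝ) (K A : SolidBody n) : Measurable fun v => bump ε K v A := by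
  classical
  have hU := isOpen_setOf_isUnit (n := n)
  refine measurable_of_restrict_of_restrict_compl hU.measurableSet ?_ ?_
  · refine Continuous.measurable (continuousOn_iff_continuous_domRestrict.1 fun v hv => ?_)
    exact (continuousAt_bump hv ε K A).continuousWithinAt
  · have : ({v : AffEndo n | IsUnit v.2}ᶜ).domRestrict (fun v => bump ε K v A) = fun _ => 0 :=
      funext fun v => bump_of_not_isUnit v.2 ε K A
    rw [this]
    exact measurable_const

/-! ### The set of affine endomorphisms mapping `S` into `T`. -/

/-- The affine endomorphisms that map `S` into `T`. -/
def mapsInto (S T : Set (Eucl n)) : Set (AffEndo n) := {v | ∀ y ∈ S, ev v y ∈ T}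

theorem mapsInto_mono (S : Set (Eucl n)) {T T' : Set (Eucl n)} (h : T ⊆ T') :
    mapsInto S T ⊆ mapsInto S T' := fun _ hv y hy => h (hv y hy)

theorem convex_mapsInto (S : Set (Eucl n)) {T : Set (Eucl n)} (hT : Convex ℝ T) :
    Convex ℝ (mapsInto S T) := by
  intro v hv u hu a b ha hb hab y hy
  rw [ev_add_smul]
  exact hT (hv y hy) (hu y hy) ha hb hab

theorem isClosed_mapsInto (S : Set (Eucl n)) {T : Set (Eucl n)} (hT : IsClosed T) :
    IsClosed (mapsInto S T) := by
  have : mapsInto S T = ⋂ y ∈ S, (fun v => ev v y) ⁻¹' T := by ext; simp [mapsInto]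
  rw [this]
  exact isClosed_biInter fun y _ => hT.preimage (continuous_ev_left y)

/-- Values on a ball control an affine map: differences over a ball of radius `r` in `S` bound the
linear part by `2R / r`, and then one value bounds the constant term. -/
theorem isCompact_mapsInto {S T : Set (Eucl n)} (hS : (interior S).Nonempty) (hT : IsCompact T) :
    IsCompact (mapsInto S T) := by
  refine Metric.isCompact_of_isClosed_isBounded (isClosed_mapsInto S hT.isClosed) ?_
  obtain ⟨y₀, hy₀⟩ := hS
  obtain ⟨r, hr, hrS⟩ := Metric.nhds_basis_closedBall.mem_iff.1 (mem_interior_iff_mem_nhds.1 hy₀)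
  obtain ⟨R, hR0, hR⟩ := hT.isBounded.exists_pos_norm_le
  have h₂ : ∀ v ∈ mapsInto S T, ‖v.2‖ ≤ (R + R) / r := by
    intro v hv
    refine v.2.opNorm_le_of_unit_norm (by positivity) fun u hu => ?_
    have h1 : ev v (y₀ + r • u) - ev v y₀ = r • v.2 u := by rw [ev_sub_ev]; simp
    have h2 : ‖r • v.2 u‖ ≤ R + R := by
      rw [← h1]
      refine (norm_sub_le _ _).trans (add_le_add (hR _ (hv _ (hrS ?_))) (hR _ (hv _ (hrS ?_))))
      · simp [norm_smul, hu, abs_of_pos hr]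
      · simp [hr.le]
    rw [norm_smul, Real.norm_of_nonneg hr.le] at h2
    rwa [le_div_iff₀ hr, mul_comm]
  have h₁ : ∀ v ∈ mapsInto S T, ‖v.1‖ ≤ R + (R + R) / r * ‖y₀‖ := by
    intro v hv
    have h1 : v.1 = ev v y₀ - v.2 y₀ := by simp [ev]
    rw [h1]
    refine (norm_sub_le _ _).trans (add_le_add (hR _ (hv _ (hrS (by simp [hr.le])))) ?_)
    exact (v.2.le_opNorm _).trans (by gcongr; exact h₂ v hv)
  refine isBounded_iff_forall_norm_le.2
    ⟨max (R + (R + R) / r * ‖y₀‖) ((R + R) / r), fun v hv => ?_⟩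
  exact max_le_max (h₁ v hv) (h₂ v hv)

theorem mem_interior_mapsInto {S T : Set (Eucl n)} (hS : Bornology.IsBounded S) {v : AffEndo n}
    {δ : ℝ} (hδ : 0 < δ) (h : ∀ y ∈ S, Metric.ball (ev v y) δ ⊆ T) :
    v ∈ interior (mapsInto S T) := by
  obtain ⟨R, hR0, hR⟩ := hS.exists_pos_norm_le
  rw [mem_interior_iff_mem_nhds, Metric.mem_nhds_iff]
  refine ⟨δ / (1 + R), by positivity, fun u hu y hy => h y hy ?_⟩
  refine (dist_ev_le_dist_mul u v (hR y hy)).trans_lt ?_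
  rwa [Metric.mem_ball, lt_div_iff₀ (by positivity)] at hu

/-- All small translates of `v` still map `S` into `T`, so the image of `S` has a uniform margin in
`T`. -/
theorem exists_ball_subset_of_mem_interior_mapsInto {S T : Set (Eucl n)} {v : AffEndo n}
    (hv : v ∈ interior (mapsInto S T)) : ∃ δ > 0, ∀ y ∈ S, Metric.ball (ev v y) δ ⊆ T := by
  obtain ⟨δ, hδ, h⟩ := Metric.mem_nhds_iff.1 (mem_interior_iff_mem_nhds.1 hv)
  refine ⟨δ, hδ, fun y hy z hz => ?_⟩
  have hu : ((v.1 + (z - ev v y), v.2) : AffEndo n) ∈ Metric.ball v δ := by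
    rw [Metric.mem_ball, dist_eq_norm] at hz ⊢
    simpa [Prod.norm_def, hδ] using hz
  have h1 : ev (v.1 + (z - ev v y), v.2) y = z := by simp only [ev]; abel
  exact h1 ▸ h hu y hy

theorem interior_mapsInto_nonempty {S T : Set (Eucl n)} (hS : Bornology.IsBounded S)
    (hT : (interior T).Nonempty) : (interior (mapsInto S T)).Nonempty := by
  obtain ⟨a, ha⟩ := hT
  obtain ⟨δ, hδ, h⟩ := Metric.mem_nhds_iff.1 (mem_interior_iff_mem_nhds.1 ha)
  exact ⟨(a, 0), mem_interior_mapsInto hS hδ fun y _ => by simpa [ev] using h⟩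

theorem eventually_mem_mapsInto {S : Set (Eucl n)} {A : SolidBody n} {v : AffEndo n}
    (hv : v ∈ interior (mapsInto S A.carrier)) : ∀ᶠ B in 𝓝 A, v ∈ mapsInto S B.carrier := by
  obtain ⟨δ, hδ, h⟩ := exists_ball_subset_of_mem_interior_mapsInto hv
  filter_upwards [Metric.ball_mem_nhds A hδ] with B hB y hy
  rw [Metric.mem_ball, dist_comm] at hB
  exact ConvexBody.mem_of_ball_subset (h y hy) hB

theorem eventually_notMem_mapsInto {S : Set (Eucl n)} {A : SolidBody n} {v : AffEndo n}
    (hv : v ∉ mapsInto S A.carrier) : ∀ᶠ B in 𝓝 A, v ∉ mapsInto S B.carrier := by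
  simp only [mapsInto, Set.mem_ofPred_eq, not_forall] at hv ⊢
  obtain ⟨y, hy, hyA⟩ := hv
  obtain ⟨δ, hδ, h⟩ := Metric.mem_nhds_iff.1 (A.1.isClosed.isOpen_compl.mem_nhds hyA)
  filter_upwards [Metric.ball_mem_nhds A hδ] with B hB
  refine ⟨y, hy, fun hyB => ?_⟩
  obtain ⟨z, hz, hyz⟩ := ConvexBody.exists_dist_le_dist (A := B.1) (B := A.1) hyB
  have hzA : z ∈ A.carrierᶜ := h (by rw [Metric.mem_ball, dist_comm]; exact hyz.trans_lt hB)
  exact hzA hz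

/-! ### Haar integrals over these sets. -/

variable (μ : Measure (AffEndo n)) [μ.IsAddHaarMeasure]

theorem integrableOn_mapsInto {F : Type*} [NormedAddCommGroup F] {S T : Set (Eucl n)}
    (hS : (interior S).Nonempty) (hT : IsCompact T)
    {f : AffEndo n → F} {b : AffEndo n → ℝ} (hf : AEStronglyMeasurable f μ) (hb : Continuous b)
    (hfb : ∀ v, ‖f v‖ ≤ b v) : IntegrableOn f (mapsInto S T) μ :=
  (hb.continuousOn.integrableOn_compact (isCompact_mapsInto hS hT)).mono' hf.restrict
    (Eventually.of_forall hfb)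

/-- Continuity of integrals over the affine endomorphisms that map `S` into a convex body. -/
theorem continuous_setIntegral_mapsInto {F : Type*} [NormedAddCommGroup F] [NormedSpace ℝ F]
    {S : Set (Eucl n)} (hS : (interior S).Nonempty) {f : AffEndo n → SolidBody n → F}
    {b : AffEndo n → ℝ} (hf : ∀ A, AEStronglyMeasurable (fun v => f v A) μ)
    (hfc : ∀ v, Continuous (f v)) (hb : Continuous b) (hfb : ∀ v A, ‖f v A‖ ≤ b v) :
    Continuous fun A : SolidBody n => ∫ v in mapsInto S A.carrier, f v A ∂μ := by
  rw [continuous_iff_continuousAt]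
  intro A
  have hmeas (B : SolidBody n) : MeasurableSet (mapsInto S B.carrier) :=
    (isClosed_mapsInto S B.1.isClosed).measurableSet
  simp only [← integral_indicator (hmeas _)]
  -- Bodies at distance less than `1` from `A` lie in its closed `1`-thickening, so `b` on this one
  -- compact set dominates all the integrands.
  have hD := isCompact_mapsInto hS (A.1.isCompact.cthickening (r := 1))
  refine tendsto_integral_filter_of_dominated_convergence
    (bound := (mapsInto S (Metric.cthickening 1 A.carrier)).indicator b) ?_ ?_ ?_ ?_
  · exact Eventually.of_forall fun B => (hf B).indicator (hmeas B)
  · filter_upwards [Metric.ball_mem_nhds A one_pos] with B hB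
    refine Eventually.of_forall fun v => ?_
    have hsub : mapsInto S B.carrier ⊆ mapsInto S (Metric.cthickening 1 A.carrier) := by
      refine mapsInto_mono S fun y hy => ?_
      obtain ⟨z, hz, hyz⟩ := ConvexBody.exists_dist_le_dist (A := B.1) (B := A.1) hy
      exact Metric.mem_cthickening_of_dist_le y z 1 _ hz (hyz.trans (le_of_lt hB))
    rw [norm_indicator_eq_indicator_norm]
    have hb0 : ∀ v, 0 ≤ b v := fun v => (norm_nonneg _).trans (hfb v A)
    refine (Set.indicator_le_indicator (hfb v B)).trans ?_
    exact Set.indicator_le_indicator_of_subset hsub hb0 v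
  · exact (hb.continuousOn.integrableOn_compact hD).integrable_indicator hD.measurableSet
  · have hfr := (convex_mapsInto S A.1.convex).addHaar_frontier μ
    filter_upwards [measure_eq_zero_iff_ae_notMem.1 hfr] with v hv
    by_cases hvA : v ∈ mapsInto S A.carrier
    · have hvi : v ∈ interior (mapsInto S A.carrier) := by
        by_contra h
        exact hv ⟨subset_closure hvA, h⟩
      rw [Set.indicator_of_mem hvA]
      refine ((hfc v).tendsto A).congr' ?_
      filter_upwards [eventually_mem_mapsInto hvi] with B hB
      rw [Set.indicator_of_mem hB]
    · rw [Set.indicator_of_notMem hvA]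
      refine tendsto_const_nhds.congr' ?_
      filter_upwards [eventually_notMem_mapsInto hvA] with B hB
      rw [Set.indicator_of_notMem hB]

/-- Composition with a nonsingular affine map, as a homeomorphism. -/
noncomputable def compHomeomorph (g : Aff n) : AffEndo n ≃ₜ AffEndo n where
  toFun := comp g
  invFun := comp g.symm
  left_inv v := by ext <;> simp [comp]
  right_inv v := by ext <;> simp [comp]
  continuous_toFun := by
    have := g.toAffineMap.continuous_of_finiteDimensional
    exact (this.comp continuous_fst).prodMk (continuous_const.clm_comp continuous_snd)
  continuous_invFun := by
    have := g.symm.toAffineMap.continuous_of_finiteDimensional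
    exact (this.comp continuous_fst).prodMk (continuous_const.clm_comp continuous_snd)

/-- Composition with `g` is a linear automorphism followed by a translation; `κ` is the absolute
value of its inverse determinant. -/
theorem exists_map_comp_eq_smul (g : Aff n) :
    ∃ κ : ℝ, 0 < κ ∧ μ.map (comp g) = ENNReal.ofReal κ • μ := by
  let e := g.linear.toContinuousLinearEquiv
  let Φ : AffEndo n ≃ₗ[ℝ] AffEndo n := LinearEquiv.prodCongr g.linear
    ((ContinuousLinearEquiv.refl ℝ (Eucl n)).arrowCongr e).toLinearEquiv
  have hdet : LinearMap.det (Φ : AffEndo n →ₗ[ℝ] AffEndo n) ≠ 0 := Φ.isUnit_det'.ne_zero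
  have hc : comp g = (fun v => v + (g 0, 0)) ∘ (Φ : AffEndo n →ₗ[ℝ] AffEndo n) := by
    funext v
    have h1 : g v.1 = g.linear v.1 + g 0 := by simpa using g.map_vadd 0 v.1
    refine Prod.ext h1 ?_
    ext1 y
    simp [comp, Φ, e]
  refine ⟨_, abs_pos.2 (inv_ne_zero hdet), ?_⟩
  rw [hc, ← Measure.map_map (measurable_add_const _)
    (LinearMap.continuous_of_finiteDimensional _).measurable,
    Measure.map_linearMap_addHaar_eq_smul_addHaar μ hdet, Measure.map_smul, map_add_right_eq_self]

theorem preimage_comp_mapsInto (g : Aff n) (S : Set (Eucl n)) (A : SolidBody n) :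
    comp g ⁻¹' mapsInto S (A.map g).carrier = mapsInto S A.carrier := by
  ext v
  simp [mapsInto, ev_comp]

/-- The factor `κ` is chosen before `F`, so the same one occurs for the real mass and the vector
moment and cancels in their quotient. -/
theorem exists_smul_setIntegral_map_eq (g : Aff n) (S : Set (Eucl n)) :
    ∃ κ : ℝ, 0 < κ ∧ ∀ {F : Type} [NormedAddCommGroup F] [NormedSpace ℝ F] (A : SolidBody n)
      (f : AffEndo n → F), κ • ∫ v in mapsInto S (A.map g).carrier, f v ∂μ =
        ∫ v in mapsInto S A.carrier, f (comp g v) ∂μ := by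
  obtain ⟨κ, hκ, hmap⟩ := exists_map_comp_eq_smul μ g
  refine ⟨κ, hκ, fun A f => ?_⟩
  have h := (compHomeomorph g).measurableEmbedding.setIntegral_map (μ := μ) f
    (mapsInto S (A.map g).carrier)
  change ∫ v in _, _ ∂μ.map (comp g) = ∫ v in comp g ⁻¹' _, f (comp g v) ∂μ at h
  rw [preimage_comp_mapsInto, hmap, Measure.restrict_smul, integral_smul_measure,
    ENNReal.toReal_ofReal hκ.le] at h
  exact h

end AffEndo

/-! ### Invariant weights and weighted means. -/

namespace AffEndo

variable {n : ℕ}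

/-- Bounded nonnegative weights, invariant under the affine group, for integrals over the affine
endomorphisms. -/
structure IsWeight (w : AffEndo n → SolidBody n → ℝ) : Prop where
  nonneg : ∀ v A, 0 ≤ w v A
  bounded : ∃ c, ∀ v A, w v A ≤ c
  measurable : ∀ A, Measurable fun v => w v A
  continuous : ∀ v, Continuous (w v)
  invariant : ∀ (g : Aff n) v A, w (comp g v) (A.map g) = w v A

theorem isWeight_bump {ε : ℝ} (hε : 0 ≤ ε) (K : SolidBody n) : IsWeight (bump ε K) where
  nonneg := bump_nonneg ε K
  bounded := ⟨ε, bump_le hε K⟩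
  measurable := measurable_bump ε K
  continuous := continuous_bump ε K
  invariant := bump_comp ε K

theorem isWeight_one : IsWeight fun (_ : AffEndo n) _ => 1 where
  nonneg _ _ := zero_le_one
  bounded := ⟨1, fun _ _ => le_rfl⟩
  measurable _ := measurable_const
  continuous _ := continuous_const
  invariant _ _ _ := rfl

theorem IsWeight.add {w w' : AffEndo n → SolidBody n → ℝ} (hw : IsWeight w) (hw' : IsWeight w') :
    IsWeight fun v A => w v A + w' v A where
  nonneg v A := add_nonneg (hw.nonneg v A) (hw'.nonneg v A)
  bounded := by
    obtain ⟨c, hc⟩ := hw.bounded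
    obtain ⟨c', hc'⟩ := hw'.bounded
    exact ⟨c + c', fun v A => add_le_add (hc v A) (hc' v A)⟩
  measurable A := (hw.measurable A).add (hw'.measurable A)
  continuous v := (hw.continuous v).add (hw'.continuous v)
  invariant g v A := by rw [hw.invariant, hw'.invariant]

variable (μ : Measure (AffEndo n)) (S : Set (Eucl n))

/-- The total weight of the affine endomorphisms that map `S` into a convex body. -/
noncomputable def mass (w : AffEndo n → SolidBody n → ℝ) (A : SolidBody n) : ℝ :=
  ∫ v in mapsInto S A.carrier, w v A ∂μ

/-- The integral of the images of `x` under the affine endomorphisms that map `S` into a convex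
body. -/
noncomputable def moment (x : Eucl n) (w : AffEndo n → SolidBody n → ℝ) (A : SolidBody n) :
    Eucl n :=
  ∫ v in mapsInto S A.carrier, w v A • ev v x ∂μ

variable {S}

namespace IsWeight

variable {w w' : AffEndo n → SolidBody n → ℝ}

theorem exists_norm_smul_le (hw : IsWeight w) (x : Eucl n) :
    ∃ b : AffEndo n → ℝ, Continuous b ∧ ∀ v A, ‖w v A • ev v x‖ ≤ b v := by
  obtain ⟨c, hc⟩ := hw.bounded
  refine ⟨fun v => c * ‖ev v x‖, continuous_const.mul (continuous_ev_left x).norm, fun v A => ?_⟩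
  rw [norm_smul, Real.norm_of_nonneg (hw.nonneg v A)]
  exact mul_le_mul_of_nonneg_right (hc v A) (norm_nonneg _)

theorem exists_norm_le (hw : IsWeight w) :
    ∃ b : AffEndo n → ℝ, Continuous b ∧ ∀ v A, ‖w v A‖ ≤ b v := by
  obtain ⟨c, hc⟩ := hw.bounded
  refine ⟨fun _ => c, continuous_const, fun v A => ?_⟩
  rw [Real.norm_of_nonneg (hw.nonneg v A)]
  exact hc v A

theorem aestronglyMeasurable_smul (hw : IsWeight w) (x : Eucl n) (A : SolidBody n) :
    AEStronglyMeasurable (fun v => w v A • ev v x) μ :=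
  ((hw.measurable A).smul (continuous_ev_left x).measurable).aestronglyMeasurable

variable [μ.IsAddHaarMeasure]

theorem integrableOn (hw : IsWeight w) (hS : (interior S).Nonempty) (A : SolidBody n) :
    IntegrableOn (fun v => w v A) (mapsInto S A.carrier) μ := by
  obtain ⟨b, hb, hwb⟩ := hw.exists_norm_le
  exact integrableOn_mapsInto μ hS A.1.isCompact (hw.measurable A).aestronglyMeasurable hb
    fun v => hwb v A

theorem integrableOn_smul (hw : IsWeight w) (hS : (interior S).Nonempty) (x : Eucl n)
    (A : SolidBody n) : IntegrableOn (fun v => w v A • ev v x) (mapsInto S A.carrier) μ := by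
  obtain ⟨b, hb, hwb⟩ := hw.exists_norm_smul_le x
  exact integrableOn_mapsInto μ hS A.1.isCompact (hw.aestronglyMeasurable_smul μ x A) hb
    fun v => hwb v A

theorem continuous_mass (hw : IsWeight w) (hS : (interior S).Nonempty) :
    Continuous (mass μ S w) := by
  obtain ⟨b, hb, hwb⟩ := hw.exists_norm_le
  exact continuous_setIntegral_mapsInto μ hS (fun A => (hw.measurable A).aestronglyMeasurable)
    hw.continuous hb hwb

theorem continuous_moment (hw : IsWeight w) (hS : (interior S).Nonempty) (x : Eucl n) :
    Continuous (moment μ S x w) := by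
  obtain ⟨b, hb, hwb⟩ := hw.exists_norm_smul_le x
  exact continuous_setIntegral_mapsInto μ hS (hw.aestronglyMeasurable_smul μ x)
    (fun v => (hw.continuous v).smul continuous_const) hb hwb

theorem mass_add (hw : IsWeight w) (hw' : IsWeight w') (hS : (interior S).Nonempty)
    (A : SolidBody n) :
    mass μ S (fun v A => w v A + w' v A) A = mass μ S w A + mass μ S w' A :=
  integral_add (hw.integrableOn μ hS A) (hw'.integrableOn μ hS A)

theorem moment_add (hw : IsWeight w) (hw' : IsWeight w') (hS : (interior S).Nonempty)
    (x : Eucl n) (A : SolidBody n) :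
    moment μ S x (fun v A => w v A + w' v A) A = moment μ S x w A + moment μ S x w' A := by
  simp only [moment, add_smul]
  exact integral_add (hw.integrableOn_smul μ hS x A) (hw'.integrableOn_smul μ hS x A)

theorem mass_pos_of_eventually (hw : IsWeight w) (hS : (interior S).Nonempty) {A : SolidBody n}
    {v : AffEndo n} (hv : v ∈ interior (mapsInto S A.carrier))
    (hpos : ∀ᶠ u in 𝓝 v, 0 < w u A) : 0 < mass μ S w A := by
  rw [mass, setIntegral_pos_iff_support_of_nonneg_ae
    (Eventually.of_forall fun u => hw.nonneg u A) (hw.integrableOn μ hS A)]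
  refine Measure.measure_pos_of_mem_nhds μ (x := v) ?_
  filter_upwards [hpos, mem_interior_iff_mem_nhds.1 hv] with u hu huA
  exact ⟨hu.ne', huA⟩

theorem mass_pos (hw : IsWeight w) (hS : (interior S).Nonempty) (hSb : Bornology.IsBounded S)
    (hpos : ∀ v A, 0 < w v A) (A : SolidBody n) : 0 < mass μ S w A := by
  obtain ⟨v, hv⟩ := interior_mapsInto_nonempty hSb A.2
  exact hw.mass_pos_of_eventually μ hS hv (Eventually.of_forall fun u => hpos u A)

/-- Weighted means of the images of a point are affine invariant points. -/
theorem smul_moment_mem_affineInvariantPoints (hw : IsWeight w) (hS : (interior S).Nonempty)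
    (hpos : ∀ A, 0 < mass μ S w A) (x : Eucl n) :
    (fun A => (mass μ S w A)⁻¹ • moment μ S x w A) ∈ affineInvariantPoints n := by
  refine ⟨((hw.continuous_mass μ hS).inv₀ fun A => (hpos A).ne').smul
    (hw.continuous_moment μ hS x), fun g A => ?_⟩
  obtain ⟨κ, hκ, h⟩ := exists_smul_setIntegral_map_eq μ g S
  have h0 : κ * mass μ S w (A.map g) = mass μ S w A := by
    refine (h A fun v => w v (A.map g)).trans ?_
    simp only [hw.invariant]
    rfl
  have hg : ∀ y, g y = LinearMap.toContinuousLinearMap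
      (g.linear : Eucl n →ₗ[ℝ] Eucl n) y + g 0 := fun y => by simpa using g.map_vadd 0 y
  -- The translation part `g 0` is integrated against the weight, hence acquires the factor `mass`,
  -- which the normalization removes.
  have h1 : κ • moment μ S x w (A.map g) = LinearMap.toContinuousLinearMap
      (g.linear : Eucl n →ₗ[ℝ] Eucl n) (moment μ S x w A) + mass μ S w A • g 0 := by
    refine (h A fun v => w v (A.map g) • ev v x).trans ?_
    rw [moment, mass, ← ContinuousLinearMap.integral_comp_comm _
      (hw.integrableOn_smul μ hS x A), ← integral_smul_const, ← integral_add
      (ContinuousLinearMap.integrable_comp _ (hw.integrableOn_smul μ hS x A))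
      ((hw.integrableOn μ hS A).smul_const _)]
    congr 1 with v : 1
    rw [hw.invariant, ev_comp, hg, smul_add, map_smul]
  have hm := hpos A
  rw [hg, map_smul]
  have h2 : (mass μ S w (A.map g))⁻¹ = (mass μ S w A)⁻¹ * κ := by
    rw [← h0, mul_inv, mul_comm κ⁻¹, mul_assoc, inv_mul_cancel₀ hκ.ne', mul_one]
  simp only [h2, mul_smul, h1, smul_add]
  rw [smul_smul, inv_mul_cancel₀ hm.ne', one_smul]

end IsWeight

/-! ### Concentration of the bump near the symmetries of `K`. -/

variable [μ.IsAddHaarMeasure]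

/-- Apply `v`, which is `‖v.2‖`-Lipschitz, to `v⁻¹A` and `B`. The bound on `vB` survives limits in
which `v` might become singular. -/
theorem dist_imageBody_le_dist_inv {v : AffEndo n} (hv : IsUnit v.2) (A B : ConvexBody (Eucl n)) :
    dist (imageBody v B) A ≤ ‖v.2‖ * dist (imageBody (inv v) A) B := by
  have h : imageBody v (imageBody (inv v) A) = A := by
    apply SetLike.coe_injective
    rw [coe_imageBody, coe_imageBody, Set.image_image]
    simp only [ev_ev_inv hv, Set.image_id']
  obtain ⟨R, hR⟩ := B.isBounded.exists_norm_le
  have := dist_imageBody_le v v (B := imageBody (inv v) A) hR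
  rw [h, dist_comm B] at this
  simpa using this

/-- The range of the linear part contains a translate of the interior of `K`, hence is everything.
-/
theorem isUnit_of_imageBody_eq {v : AffEndo n} {A : ConvexBody (Eucl n)} {K : SolidBody n}
    (h : imageBody v A = K.1) : IsUnit v.2 := by
  have hsub : (fun y => v.1 + y) ⁻¹' interior K.carrier ⊆ v.2.range := by
    intro y hy
    have hyK : v.1 + y ∈ (K.1 : Set (Eucl n)) := interior_subset (s := K.carrier) hy
    rw [← h, coe_imageBody] at hyK
    obtain ⟨z, -, hz⟩ := hyK
    exact ⟨z, add_left_cancel hz⟩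
  have hne : (interior (v.2.range : Set (Eucl n))).Nonempty := by
    obtain ⟨a, ha⟩ := K.2
    refine ⟨a - v.1, interior_maximal hsub (isOpen_interior.preimage (by fun_prop)) ?_⟩
    rw [Set.mem_preimage, add_sub_cancel]
    exact ha
  have hsurj : Function.Surjective v.2 :=
    LinearMap.range_eq_top.1 (Submodule.eq_top_of_nonempty_interior' _ hne)
  exact isUnit_iff_bijective.2
    ⟨(LinearMap.injective_iff_surjective (f := (v.2 : Eucl n →ₗ[ℝ] Eucl n))).2 hsurj, hsurj⟩

theorem ev_eq_of_imageBody_eq {v : AffEndo n} {K : SolidBody n} (h : imageBody v K.1 = K.1)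
    {x : Eucl n} (hx : x ∈ affineFixedPoints K) : ev v x = x := by
  let e : Eucl n ≃ₗ[ℝ] Eucl n := LinearEquiv.ofBijective (v.2 : Eucl n →ₗ[ℝ] Eucl n)
    (isUnit_iff_bijective.1 (isUnit_of_imageBody_eq h))
  let g : Aff n := e.toAffineEquiv.trans (AffineEquiv.constVAdd ℝ (Eucl n) v.1)
  have hg : ∀ y, g y = ev v y := fun y => rfl
  rw [← hg]
  refine hx g (Subtype.ext (SetLike.coe_injective ?_))
  exact congrArg (fun B : ConvexBody (Eucl n) => (B : Set (Eucl n))) h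

/-- The affine maps that move `K` little move the fixed points of the symmetries of `K` little. -/
theorem exists_bump_concentrated (hS : (interior S).Nonempty) {K : SolidBody n} {x : Eucl n}
    (hx : x ∈ affineFixedPoints K) {η : ℝ} (hη : 0 < η) :
    ∃ ε > 0, ∀ v ∈ mapsInto S K.carrier, bump ε K v K ≠ 0 → dist (ev v x) x ≤ η := by
  -- Counterexamples for `ε = 1 / (k + 1)` accumulate at some `u` with `uK = K`. Thus `u` is a
  -- symmetry of `K` and fixes `x`, against `dist (ev u x) x ≥ η`.
  by_contra! hcon
  choose v hvS hvb hvx using fun k : ℕ => hcon (1 / ((k : ℝ) + 1)) Nat.one_div_pos_of_nat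
  obtain ⟨u, -, φ, hφ, hlim⟩ := (isCompact_mapsInto hS K.1.isCompact).tendsto_subseq hvS
  have hunit : ∀ k, IsUnit (v k).2 := fun k => by
    by_contra h
    exact hvb k (bump_of_not_isUnit h _ _ _)
  have hd : ∀ k, dist (imageBody (v k) K.1) K.1 ≤ ‖(v k).2‖ * (1 / ((k : ℝ) + 1)) := fun k => by
    refine (dist_imageBody_le_dist_inv (hunit k) K.1 K.1).trans ?_
    gcongr
    have := hvb k
    rw [bump_of_isUnit (hunit k)] at this
    contrapose! this
    exact max_eq_left (sub_nonpos.2 this.le)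
  have hl1 : Tendsto (fun k => dist (imageBody (v (φ k)) K.1) K.1) atTop
      (𝓝 (dist (imageBody u K.1) K.1)) := by
    have hc : Continuous fun v : AffEndo n => dist (imageBody v K.1) K.1 :=
      (continuous_imageBody.comp (continuous_id.prodMk continuous_const)).dist continuous_const
    exact (hc.tendsto u).comp hlim
  have hl2 : Tendsto (fun k => ‖(v (φ k)).2‖ * (1 / ((φ k : ℝ) + 1))) atTop (𝓝 (‖u.2‖ * 0)) :=
    (((continuous_snd.norm (E := Eucl n →L[ℝ] Eucl n)).tendsto u).comp hlim).mul
      (tendsto_one_div_add_atTop_nhds_zero_nat.comp hφ.tendsto_atTop)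
  have hu : imageBody u K.1 = K.1 := by
    have := le_of_tendsto_of_tendsto' hl1 hl2 fun k => hd (φ k)
    rw [mul_zero] at this
    exact dist_le_zero.1 this
  have hl3 : Tendsto (fun k => dist (ev (v (φ k)) x) x) atTop (𝓝 (dist (ev u x) x)) :=
    (((continuous_ev_left x).dist continuous_const).tendsto u).comp hlim
  have := ge_of_tendsto' hl3 fun k => (hvx (φ k)).le
  rw [ev_eq_of_imageBody_eq hu hx, dist_self] at this
  exact hη.not_ge this

theorem eventually_bump_pos {ε : ℝ} (hε : 0 < ε) (K : SolidBody n) :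
    ∀ᶠ v in 𝓝 ((0, 1) : AffEndo n), 0 < bump ε K v K := by
  have h1 : IsUnit ((0, 1) : AffEndo n).2 := isUnit_one
  refine (continuousAt_bump h1 ε K K).eventually (lt_mem_nhds ?_)
  have : imageBody (inv (0, 1)) K.1 = K.1 := by
    apply SetLike.coe_injective
    have h (y : Eucl n) : ev (inv (0, 1)) y = y := by simp [inv, ev]
    simp only [coe_imageBody, h, Set.image_id']
  simp [bump_of_isUnit h1, this, hε]

theorem dist_smul_moment_le {w : AffEndo n → SolidBody n → ℝ} (hw : IsWeight w)
    (hS : (interior S).Nonempty) {A : SolidBody n} (hpos : 0 < mass μ S w A) {x y : Eucl n}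
    {η : ℝ} (h : ∀ v ∈ mapsInto S A.carrier, w v A ≠ 0 → dist (ev v x) y ≤ η) :
    dist ((mass μ S w A)⁻¹ • moment μ S x w A) y ≤ η := by
  have h1 : moment μ S x w A - mass μ S w A • y =
      ∫ v in mapsInto S A.carrier, w v A • (ev v x - y) ∂μ := by
    simp only [smul_sub]
    rw [integral_sub (hw.integrableOn_smul μ hS x A) ((hw.integrableOn μ hS A).smul_const y),
      integral_smul_const, moment, mass]
  have h2 : ‖moment μ S x w A - mass μ S w A • y‖ ≤ mass μ S w A * η := by
    rw [h1, mass, ← integral_mul_const]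
    refine norm_integral_le_of_norm_le ((hw.integrableOn μ hS A).mul_const η) ?_
    filter_upwards [ae_restrict_mem (isClosed_mapsInto S A.1.isClosed).measurableSet] with v hv
    rw [norm_smul, Real.norm_of_nonneg (hw.nonneg v A), ← dist_eq_norm]
    rcases eq_or_ne (w v A) 0 with h0 | h0
    · simp [h0]
    · exact mul_le_mul_of_nonneg_left (h v hv h0) (hw.nonneg v A)
  have h3 : (mass μ S w A)⁻¹ • moment μ S x w A - y =
      (mass μ S w A)⁻¹ • (moment μ S x w A - mass μ S w A • y) := by
    rw [smul_sub, smul_smul, inv_mul_cancel₀ hpos.ne', one_smul]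
  rw [dist_eq_norm, h3, norm_smul, norm_inv, Real.norm_of_nonneg hpos.le, inv_mul_le_iff₀ hpos]
  exact h2

end AffEndo

/-! ### The affine subspace of values, and the conclusion. -/

/-- The values of the affine invariant points at a convex body form an affine subspace. -/
def affineInvariantValuesSubspace {n : ℕ} (K : SolidBody n) : AffineSubspace ℝ (Eucl n) where
  carrier := affineInvariantValues K
  smul_vsub_vadd_mem' := by
    rintro c _ _ _ ⟨p, ⟨hpc, hp⟩, rfl⟩ ⟨q, ⟨hqc, hq⟩, rfl⟩ ⟨r, ⟨hrc, hr⟩, rfl⟩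
    refine ⟨fun A => c • (p A -ᵥ q A) +ᵥ r A, ⟨?_, fun g A => ?_⟩, rfl⟩
    · simp only [vsub_eq_sub, vadd_eq_add]
      fun_prop
    · simp only [hp, hq, hr]
      rw [g.map_vadd, map_smul]
      congr 2
      exact (g.toAffineMap.linearMap_vsub _ _).symm

open AffEndo in
theorem smul_moment_mem_affineInvariantValues {n : ℕ} (μ : Measure (AffEndo n))
    [μ.IsAddHaarMeasure] {S : Set (Eucl n)} (hS : (interior S).Nonempty)
    (hSb : Bornology.IsBounded S) {w : AffEndo n → SolidBody n → ℝ} (hw : IsWeight w)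
    {K : SolidBody n} (hpos : 0 < mass μ S w K) (x : Eucl n) :
    (mass μ S w K)⁻¹ • moment μ S x w K ∈ affineInvariantValues K := by
  have h1 := isWeight_one (n := n)
  have h1pos := h1.mass_pos μ hS hSb (fun _ _ => one_pos)
  have h2 := h1.add hw
  have h2pos := h2.mass_pos μ hS hSb fun v A => add_pos_of_pos_of_nonneg one_pos (hw.nonneg v A)
  have hp := h1.smul_moment_mem_affineInvariantPoints μ hS h1pos x
  have hq := h2.smul_moment_mem_affineInvariantPoints μ hS h2pos x
  -- With `c = mass (1 + w) / mass w` at `K`, additivity of mass and moment gives mean of `w` = `c`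
  -- (mean of `1 + w` − mean of `1`) + mean of `1`.
  obtain ⟨p, hpinv, hpK⟩ := (affineInvariantValuesSubspace K).smul_vsub_vadd_mem
    ((mass μ S (fun v A => 1 + w v A) K) / mass μ S w K)
    (p₁ := _) (p₂ := _) (p₃ := _) ⟨_, hq, rfl⟩ ⟨_, hp, rfl⟩ ⟨_, hp, rfl⟩
  refine ⟨p, hpinv, hpK.trans ?_⟩
  simp only [vsub_eq_sub, vadd_eq_add]
  have hne : mass μ S (fun _ _ => 1) K + mass μ S w K ≠ 0 := by linarith [h1pos K]
  have hne1 := (h1pos K).ne'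
  rw [h1.mass_add μ hw hS, h1.moment_add μ hw hS]
  match_scalars <;> field_simp
  ring

open AffEndo in
theorem theorem3p1 (n : ℕ) (K : SolidBody n) :
    (∀ x ∈ affineFixedPoints K, ∃ p ∈ affineInvariantPoints n, p K = x) ∧
      affineInvariantValues K = affineFixedPoints K := by
  have key : ∀ x ∈ affineFixedPoints K, x ∈ affineInvariantValues K := by
    intro x hx
    obtain ⟨y₀, hy₀⟩ := K.2
    obtain ⟨r, hr, hrK⟩ := Metric.mem_nhds_iff.1 (mem_interior_iff_mem_nhds.1 hy₀)
    -- Halving the radius leaves a margin `r / 2` around `S` in `K`, so the identity is interior to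
    -- `mapsInto S K.carrier` and the bump has positive mass there.
    set S := Metric.ball y₀ (r / 2) with hSdef
    have hS : (interior S).Nonempty := by
      rw [Metric.isOpen_ball.interior_eq]
      exact Metric.nonempty_ball.2 (half_pos hr)
    have hSb : Bornology.IsBounded S := Metric.isBounded_ball
    let μ : Measure (AffEndo n) := Measure.addHaar
    have hid : ((0, 1) : AffEndo n) ∈ interior (mapsInto S K.carrier) := by
      refine mem_interior_mapsInto hSb (half_pos hr) fun y hy => ?_
      have : ev ((0, 1) : AffEndo n) y = y := by simp [ev]
      rw [this]
      refine (Metric.ball_subset_ball' ?_).trans hrK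
      linarith [Metric.mem_ball.1 hy]
    have hcl : IsClosed (affineInvariantValues K) :=
      (affineInvariantValuesSubspace K).closed_of_finiteDimensional
    rw [← hcl.closure_eq, Metric.mem_closure_iff]
    intro η hη
    obtain ⟨ε, hε, hbump⟩ := exists_bump_concentrated hS hx (half_pos hη)
    have hw := isWeight_bump hε.le K
    have hpos := hw.mass_pos_of_eventually μ hS hid (eventually_bump_pos hε K)
    refine ⟨_, smul_moment_mem_affineInvariantValues μ hS hSb hw hpos x, ?_⟩
    rw [dist_comm]
    exact (dist_smul_moment_le μ hw hS hpos hbump).trans_lt (half_lt_self hη)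
  refine ⟨key, Set.Subset.antisymm ?_ key⟩
  rintro _ ⟨p, ⟨-, hp⟩, rfl⟩ g hg
  rw [← hp, hg]
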